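/- Work in $\mathbb R^n$, $n\ge 1$, with Lebesgue measure $|\cdot|$, and with half-open dyadic cubes $Q=2^{-k}(m+[0,1)^n)$, $k\in\mathbb Z$, $m\in\mathbb Z^n$, of side length $\ell(Q)=2^{-k}$. For $0<\eta<1$, a family $\mathcal S$ of dyadic cubes is $\eta$-sparse if there are pairwise disjoint measurable sets $E(Q)\subseteq Q$ ($Q\in\mathcal S$) with $|E(Q)|\ge \eta|Q|$. Let $\mathcal S$ consist of cubes contained in the unit cube $[0,1)^n$. Define the layers of $\mathcal S$ recursively: $\mathcal S^{\{j\}}$ is the set of maximal cubes (for inclusion) of $\mathcal S\setminus(\mathcal S^{\{0\}}\cup\dots\cup\mathcal S^{\{j-1\}})$. Assume $\mathcal S^{\{0\}}=\{[0,1)^n\}$ and $\mathcal S^{\{1\}}\neq\emptyset$, and put $\mathfrak S_j=\inf_{Q\in\mathcal S^{\{j\}}}\ell(Q)$. The family $\mathcal S$ is graded if $$K_{\mathcal S}:=\sup_{j\ge 0}\ \log_2\frac{\mathfrak S_j}{\mathfrak S_{j+1}}<\infty$$ (empty layers contribute nothing to the supremum), and then $K_{\mathcal S}$ is its degree. For $t>1$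 put $$\mathbb A_{\mathcal S}^t f(x)=\sum_{Q\in\mathcal S}\frac{\mathbf 1_Q(x)}{|Q|^t}\int_Q|f(y)|\,dy .$$ For $1\le p<\infty$ let $\|f\|_{L^{p,\infty}}=\sup_{\lambda>0}\lambda\,|\{|f|>\lambda\}|^{1/p}$ and $\|f\|_{L^{p,1}}=p\int_0^\infty|\{|f|>\lambda\}|^{1/p}\,d\lambda$; also $L^{\infty,\infty}=L^\infty$. **Theorem.** Let $\mathcal S$ be a graded $\eta$-sparse family as above with degree $K_{\mathcal S}$, and let $1<t<1-\frac{\log_2(1-\eta)}{nK_{\mathcal S}}$. Then the following operators are bounded, with operator norms bounded by a finite constant that depends only on $n,\eta,K_{\mathcal S},t,p,q$ and not otherwise on $\mathcal S$. 1. (Off the critical line) $\mathbb A_{\mathcal S}^t:L^p(\mathbb R^n)\to L^q(\mathbb R^n)$ for all $1\le p,q\le\infty$ with $\frac1q-\frac1p>\frac{nK_{\mathcal S}(t-1)}{-\log_2(1-\eta)}$. 2. (On the critical line) (a) $\mathbb A_{\mathcal S}^t:L^{p,\infty}(\mathbb R^n)\to L^{q,\infty}(\mathbb R^n)$, and in particular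 $\mathbb A_{\mathcal S}^t:L^{p}(\mathbb R^n)\to L^{q,\infty}(\mathbb R^n)$, for all $1\le p,q\le\infty$ with $\frac1q-\frac1p=\frac{nK_{\mathcal S}(t-1)}{-\log_2(1-\eta)}$ and $q\ne1$. (b) $\mathbb A_{\mathcal S}^t:L^{p,1}(\mathbb R^n)\to L^{1,\infty}(\mathbb R^n)$ for $p=\frac{-\log_2(1-\eta)}{-\log_2(1-\eta)+nK_{\mathcal S}(1-t)}$. -/

import Mathlib

open MeasureTheory Set
open scoped NNReal ENNReal

/-- Index of the half-open dyadic cube `2^(-scale) (pos + [0,1)^n)` of `ℝ^n`.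
Functions live on `Fin n → ℝ` with Lebesgue measure `volume`. -/
structure DyadicCube (n : ℕ) where
  scale : ℤ
  pos : Fin n → ℤ

namespace DyadicCube

variable {n : ℕ}

/-- The side length `ℓ(Q)`. -/
noncomputable def sideLength (Q : DyadicCube n) : ℝ := (2 : ℝ) ^ (-Q.scale)

/-- The cube as a set of points. -/
noncomputable def toSet (Q : DyadicCube n) : Set (Fin n → ℝ) :=
  Set.univ.pi fun i => Set.Ico ((Q.pos i : ℝ) * Q.sideLength) (((Q.pos i : ℝ) + 1) * Q.sideLength)

/-- The unit cube. -/
def unit (n : ℕ) : DyadicCube n := ⟨0, fun _ => 0⟩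

end DyadicCube

/-- `η`-sparse families: each cube `Q` has a measurable subset `E Q` of measure at least `η |Q|`,
and these subsets are pairwise disjoint. -/
def IsSparseFamily {n : ℕ} (η : ℝ) (S : Set (DyadicCube n)) : Prop :=
  ∃ E : DyadicCube n → Set (Fin n → ℝ),
    (∀ Q ∈ S, MeasurableSet (E Q)) ∧
    (∀ Q ∈ S, E Q ⊆ Q.toSet) ∧
    (∀ Q ∈ S, ENNReal.ofReal η * volume Q.toSet ≤ volume (E Q)) ∧
    S.PairwiseDisjoint E

/-- The cubes of `G` that are maximal in `G` for inclusion. -/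
def maximalCubes {n : ℕ} (G : Set (DyadicCube n)) : Set (DyadicCube n) :=
  {Q | Q ∈ G ∧ ∀ Q' ∈ G, Q.toSet ⊆ Q'.toSet → Q'.toSet ⊆ Q.toSet}

/-- What is left of `G` after its first `j` layers have been removed. -/
def remainingCubes {n : ℕ} (G : Set (DyadicCube n)) : ℕ → Set (DyadicCube n)
  | 0 => G
  | j + 1 => remainingCubes G j \ maximalCubes (remainingCubes G j)

/-- The `j`-th layer of `G`: the maximal cubes among those not in an earlier layer. -/
def layer {n : ℕ} (G : Set (DyadicCube n)) (j : ℕ) : Set (DyadicCube n) :=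
  maximalCubes (remainingCubes G j)

/-- The infimum of the side lengths in the `j`-th layer (`∞` if the layer is empty). -/
noncomputable def layerScale {n : ℕ} (G : Set (DyadicCube n)) (j : ℕ) : ℝ≥0∞ :=
  ⨅ Q ∈ layer G j, ENNReal.ofReal Q.sideLength

/-- The degree of `G`: the supremum over `j` of `log₂ (layerScale G j / layerScale G (j + 1))`.
An empty layer `j + 1` contributes `log₂ 0 = -∞`, hence nothing; a layer whose side lengths have
infimum `0` makes the supremum `+∞`. -/
noncomputable def familyDegree {n : ℕ} (G : Set (DyadicCube n)) : EReal :=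
  ⨆ j : ℕ, ENNReal.log (layerScale G j / layerScale G (j + 1)) / ((Real.log 2 : ℝ) : EReal)

/-- Graded families of dyadic subcubes of the unit cube. -/
structure IsGradedFamily {n : ℕ} (G : Set (DyadicCube n)) : Prop where
  subset_unit : ∀ Q ∈ G, Q.toSet ⊆ (DyadicCube.unit n).toSet
  layer_zero : layer G 0 = {DyadicCube.unit n}
  degree_lt_top : familyDegree G < ⊤

/-- The hypersingular sparse operator `∑_{Q ∈ S} 1_Q(x) |Q|^(-t) ∫_Q |f|`, as a function with
values in `[0, ∞]`. -/
noncomputable def hypersingularSparse {n : ℕ} (S : Set (DyadicCube n)) (t : ℝ)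
    (f : (Fin n → ℝ) → ℂ) (x : Fin n → ℝ) : ℝ≥0∞ :=
  ∑' Q : S, (Q : DyadicCube n).toSet.indicator
    (fun _ => (volume (Q : DyadicCube n).toSet) ^ (-t) * ∫⁻ y in (Q : DyadicCube n).toSet, ‖f y‖ₑ) x

/-- The quasi-norm of weak `L^p`, `sup_{s > 0} s |{|g| > s}|^(1/p)`; for `p = ∞` the space
`L^{∞,∞}` is `L^∞`. -/
noncomputable def weakLpNorm {n : ℕ} {E : Type*} [ENorm E] (g : (Fin n → ℝ) → E) (p : ℝ≥0∞) :
    ℝ≥0∞ :=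
  if p = ⊤ then eLpNormEssSup g volume
  else ⨆ s : ℝ≥0, (s : ℝ≥0∞) * (volume {x | (s : ℝ≥0∞) < ‖g x‖ₑ}) ^ (1 / p.toReal)

/-- The Lorentz norm of `L^{p,1}` for finite `p`, `p ∫_0^∞ |{|g| > s}|^(1/p) ds`. -/
noncomputable def lorentzOneNorm {n : ℕ} {E : Type*} [ENorm E] (g : (Fin n → ℝ) → E) (p : ℝ) :
    ℝ≥0∞ :=
  ENNReal.ofReal p *
    ∫⁻ s in Set.Ioi (0 : ℝ), (volume {x | ENNReal.ofReal s < ‖g x‖ₑ}) ^ (1 / p)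

/-!
Write `θ = n K (t - 1) / (-log₂ (1 - η))` for the critical exponent; the hypothesis on `t` says that
`0 < θ < 1`. Two facts about the layers of a graded sparse family drive the proof.

* Sparseness gives decay (`tsum_volume_remainingCubes_le`). If `R j` is the total volume of the
  cubes left after `j` layers, then `η R j` is at most the volume of the sets `E Q` of these cubes,
  hence at most the volume `R j - R (j + 1)` of the `j`-th layer, which covers all of them. So
  `R j ≤ (1 - η) ^ j / η`.
* Grading bounds growth (`volume_rpow_neg_le`). A cube of the `j`-th layer has side length at least
  `2 ^ (-K j)`, so that `|Q| ^ (-t) ≤ B ^ j / |Q|` with `B = 2 ^ (n K (t - 1)) = (1 - η) ^ (-θ)`.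

Therefore the operator is dominated by `∑ j, (1 - η) ^ (-θ j) M j`, where `M j` averages over the
disjoint cubes of the `j`-th layer. Each `M j` is bounded on weak `L^p` for `p > 1`, uniformly in
`j`: its integral over `F` is the integral of `|f|` against a density that is at most `1` and has
mass at most `|F|` (`exists_setLIntegral_averages_le`, from `exists_lintegral_le_of_hasWeakBound`).

The critical estimate is `exists_weak_type_bound`. Let `m` be the measure of the level set where the
operator exceeds `s`, and choose the first `N` for which `(1 - η) ^ N / η ≤ m / 2`. At least half of
the level set avoids all cubes of the layers from `N` on, and there only the first `N` terms act.
Their geometric sum is of the size of its last term, which is comparable to `m ^ (-θ)`, so that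
`s m ≲ m ^ (1 - 1/p - θ) ‖f‖`, and this is the weak-type bound with `1/q = 1/p + θ`. It holds on
weak `L^p` for every `q ≥ 1`. The endpoint `q = 1` on `L^{p,1}` follows because `L^{p,1}` embeds
into weak `L^p`. The strong bounds off the critical line follow because the operator vanishes off
the unit cube, where weak `L^{q₀}` embeds into `L^q` for `q < q₀` (`exists_eLpNorm_le_of_weak`).
-/

/-! ### Geometry of dyadic cubes -/

namespace DyadicCube

variable {n : ℕ}

theorem sideLength_pos (Q : DyadicCube n) : 0 < Q.sideLength := by
  unfold sideLength; positivity

/-- Membership in a dyadic cube is a statement about integer parts; this is what makes dyadic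
cubes nested. -/
theorem mem_toSet_iff (Q : DyadicCube n) (x : Fin n → ℝ) :
    x ∈ Q.toSet ↔ ∀ i, ⌊x i * (2 : ℝ) ^ Q.scale⌋ = Q.pos i := by
  have h2 : (0 : ℝ) < 2 ^ Q.scale := by positivity
  simp only [toSet, Set.mem_univ_pi, Set.mem_Ico, Int.floor_eq_iff, sideLength, zpow_neg]
  refine forall_congr' fun i => ?_
  rw [← div_eq_mul_inv, ← div_eq_mul_inv, div_le_iff₀ h2, lt_div_iff₀ h2]

theorem toSet_nonempty (Q : DyadicCube n) : Q.toSet.Nonempty := by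
  refine ⟨fun i => Q.pos i * (2 : ℝ) ^ (-Q.scale), (mem_toSet_iff _ _).2 fun i => ?_⟩
  have : (Q.pos i : ℝ) * 2 ^ (-Q.scale) * 2 ^ Q.scale = Q.pos i := by
    rw [mul_assoc, ← zpow_add₀ (by norm_num)]; simp
  rw [this]; simp

theorem measurableSet_toSet (Q : DyadicCube n) : MeasurableSet Q.toSet :=
  MeasurableSet.univ_pi fun _ => measurableSet_Ico

theorem volume_toSet (Q : DyadicCube n) :
    volume Q.toSet = ENNReal.ofReal (Q.sideLength ^ n) := by
  rw [toSet, volume_pi_pi]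
  simp only [Real.volume_Ico]
  rw [ENNReal.ofReal_pow Q.sideLength_pos.le]
  have : ∀ i, ((Q.pos i : ℝ) + 1) * Q.sideLength - Q.pos i * Q.sideLength = Q.sideLength :=
    fun i => by ring
  simp [this]

theorem volume_toSet_ne_zero (Q : DyadicCube n) : volume Q.toSet ≠ 0 := by
  rw [volume_toSet]
  have := pow_pos Q.sideLength_pos n
  simpa using this

theorem volume_toSet_ne_top (Q : DyadicCube n) : volume Q.toSet ≠ ⊤ := by
  rw [volume_toSet]; exact ENNReal.ofReal_ne_top

/-- If two dyadic cubes meet, the one of the finer scale lies in the other. -/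
theorem toSet_subset_of_mem {Q Q' : DyadicCube n} (h : Q'.scale ≤ Q.scale) {x : Fin n → ℝ}
    (hx : x ∈ Q.toSet) (hx' : x ∈ Q'.toSet) : Q.toSet ⊆ Q'.toSet := by
  intro y hy
  rw [mem_toSet_iff] at *
  obtain ⟨d, hd⟩ := Int.le.dest h
  -- the integer part at the coarse scale is determined by the one at the fine scale
  have key : ∀ z : ℝ, ⌊z * (2 : ℝ) ^ Q'.scale⌋ = ⌊z * (2 : ℝ) ^ Q.scale⌋ / ((2 ^ d : ℕ) : ℤ) := by
    intro z
    rw [← Int.floor_div_natCast, ← hd, zpow_add₀ (by norm_num)]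
    congr 1
    push_cast
    rw [zpow_natCast]
    field_simp
  intro i
  rw [key, hy i, ← hx i, ← key, hx' i]

theorem disjoint_or_subset_or_subset (Q Q' : DyadicCube n) :
    Disjoint Q.toSet Q'.toSet ∨ Q.toSet ⊆ Q'.toSet ∨ Q'.toSet ⊆ Q.toSet := by
  by_cases h : Disjoint Q.toSet Q'.toSet
  · exact Or.inl h
  · obtain ⟨x, hx, hx'⟩ := Set.not_disjoint_iff.1 h
    rcases le_total Q'.scale Q.scale with hs | hs
    · exact Or.inr (Or.inl (toSet_subset_of_mem hs hx hx'))
    · exact Or.inr (Or.inr (toSet_subset_of_mem hs hx' hx))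

theorem scale_le_of_subset (hn : 1 ≤ n) {Q Q' : DyadicCube n} (h : Q.toSet ⊆ Q'.toSet) :
    Q'.scale ≤ Q.scale := by
  have h1 := measure_mono (μ := volume) h
  rw [volume_toSet, volume_toSet,
    ENNReal.ofReal_le_ofReal_iff (pow_nonneg Q'.sideLength_pos.le n),
    pow_le_pow_iff_left₀ Q.sideLength_pos.le Q'.sideLength_pos.le (by omega)] at h1
  unfold sideLength at h1
  have := (zpow_le_zpow_iff_right₀ (by norm_num : (1 : ℝ) < 2)).1 h1
  omega

theorem scale_lt_of_ssubset (hn : 1 ≤ n) {Q Q' : DyadicCube n} (h : Q.toSet ⊆ Q'.toSet)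
    (h' : ¬ Q'.toSet ⊆ Q.toSet) : Q'.scale < Q.scale := by
  refine lt_of_le_of_ne (scale_le_of_subset hn h) fun he => h' ?_
  obtain ⟨x, hx⟩ := Q.toSet_nonempty
  exact toSet_subset_of_mem he.ge (h hx) hx

/-- In positive dimension a dyadic cube is determined by its points. -/
theorem toSet_injective (hn : 1 ≤ n) : Function.Injective (toSet : DyadicCube n → _) := by
  intro Q Q' h
  have hs : Q.scale = Q'.scale :=
    le_antisymm (scale_le_of_subset hn h.ge) (scale_le_of_subset hn h.le)
  obtain ⟨x, hx⟩ := Q.toSet_nonempty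
  have hx' : x ∈ Q'.toSet := h ▸ hx
  rw [mem_toSet_iff] at hx hx'
  have hp : Q.pos = Q'.pos := by
    funext i; rw [← hx i, ← hx' i, hs]
  cases Q; cases Q'; simp_all

instance : Countable (DyadicCube n) := by
  have : Function.Injective (fun Q : DyadicCube n => (Q.scale, Q.pos)) := by
    rintro ⟨a, b⟩ ⟨c, d⟩ h
    simpa using h
  exact this.countable

theorem volume_unit : volume (unit n).toSet = 1 := by
  rw [volume_toSet]; simp [unit, sideLength]

end DyadicCube

/-! ### Layers of sparse and graded families -/

section Layers

variable {n : ℕ} {G : Set (DyadicCube n)}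

theorem remainingCubes_succ_union_layer (G : Set (DyadicCube n)) (j : ℕ) :
    layer G j ∪ remainingCubes G (j + 1) = remainingCubes G j := by
  simp only [layer, remainingCubes]
  exact Set.union_sdiff_cancel fun Q hQ => hQ.1

theorem disjoint_layer_remainingCubes_succ (G : Set (DyadicCube n)) (j : ℕ) :
    Disjoint (layer G j) (remainingCubes G (j + 1)) := by
  simp only [layer, remainingCubes]
  exact Set.disjoint_sdiff_right

theorem remainingCubes_subset (G : Set (DyadicCube n)) (j : ℕ) : remainingCubes G j ⊆ G := by
  induction j with
  | zero => exact subset_rfl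
  | succ j ih => exact Set.sdiff_subset.trans ih

/-- Every removed layer costs one dyadic generation. -/
theorem le_scale_of_mem_remainingCubes (hn : 1 ≤ n)
    (hG : ∀ Q ∈ G, Q.toSet ⊆ (DyadicCube.unit n).toSet) (j : ℕ) :
    ∀ Q ∈ remainingCubes G j, (j : ℤ) ≤ Q.scale := by
  induction j with
  | zero => intro Q hQ; simpa [DyadicCube.unit] using DyadicCube.scale_le_of_subset hn (hG Q hQ)
  | succ j ih =>
    rintro Q ⟨hQ, hmax⟩
    simp only [maximalCubes, Set.mem_ofPred_eq, not_and, not_forall] at hmax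
    obtain ⟨Q', hQ', hsub, hnot⟩ := hmax hQ
    have h1 := ih Q' hQ'
    have h2 := DyadicCube.scale_lt_of_ssubset hn hsub hnot
    push_cast
    omega

theorem exists_mem_layer_of_notMem_remainingCubes {Q : DyadicCube n} (hQ : Q ∈ G) (N : ℕ)
    (h : Q ∉ remainingCubes G N) : ∃ j < N, Q ∈ layer G j := by
  induction N with
  | zero => exact absurd hQ h
  | succ N ih =>
    by_cases hN : Q ∈ remainingCubes G N
    · rw [← remainingCubes_succ_union_layer] at hN
      exact ⟨N, N.lt_succ_self, hN.resolve_right h⟩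
    · obtain ⟨j, hj, hQj⟩ := ih hN
      exact ⟨j, hj.trans N.lt_succ_self, hQj⟩

theorem pairwiseDisjoint_layer (hn : 1 ≤ n) (G : Set (DyadicCube n)) (j : ℕ) :
    (layer G j).PairwiseDisjoint DyadicCube.toSet := by
  intro Q hQ Q' hQ' hne
  rcases DyadicCube.disjoint_or_subset_or_subset Q Q' with h | h | h
  · exact h
  · exact absurd (DyadicCube.toSet_injective hn (h.antisymm (hQ.2 Q' hQ'.1 h))) hne
  · exact absurd (DyadicCube.toSet_injective hn ((hQ'.2 Q hQ.1 h).antisymm h)) hne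

theorem exists_mem_layer_superset (hn : 1 ≤ n)
    (hG : ∀ Q ∈ G, Q.toSet ⊆ (DyadicCube.unit n).toSet) {j : ℕ} {Q : DyadicCube n}
    (hQ : Q ∈ remainingCubes G j) : ∃ Q' ∈ layer G j, Q.toSet ⊆ Q'.toSet := by
  -- climb to a coarser cube as long as there is one; scales are nonnegative
  suffices H : ∀ k : ℕ, ∀ Q ∈ remainingCubes G j, Q.scale ≤ k →
      ∃ Q' ∈ layer G j, Q.toSet ⊆ Q'.toSet from H Q.scale.toNat Q hQ (Int.self_le_toNat _)
  intro k
  induction k with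
  | zero =>
    intro Q hQ hk
    refine ⟨Q, ⟨hQ, fun Q' hQ' hsub => ?_⟩, subset_rfl⟩
    by_contra hnot
    have h1 := DyadicCube.scale_lt_of_ssubset hn hsub hnot
    have h2 := le_scale_of_mem_remainingCubes hn hG j Q' hQ'
    push_cast at hk
    omega
  | succ k ih =>
    intro Q hQ hk
    by_cases hmax : ∀ Q' ∈ remainingCubes G j, Q.toSet ⊆ Q'.toSet → Q'.toSet ⊆ Q.toSet
    · exact ⟨Q, ⟨hQ, hmax⟩, subset_rfl⟩
    · push Not at hmax
      obtain ⟨Q', hQ', hsub, hnot⟩ := hmax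
      have h1 := DyadicCube.scale_lt_of_ssubset hn hsub hnot
      push_cast at hk
      obtain ⟨Q'', hQ'', hsub'⟩ := ih Q' hQ' (by omega)
      exact ⟨Q'', hQ'', hsub.trans hsub'⟩

/-- A sparse family is a Carleson family. -/
theorem ofReal_mul_tsum_volume_le {η : ℝ} (hS : IsSparseFamily η G) {T : Set (DyadicCube n)}
    (hT : T ⊆ G) {U : Set (Fin n → ℝ)} (hU : ∀ Q ∈ T, Q.toSet ⊆ U) :
    ENNReal.ofReal η * ∑' Q : T, volume (Q : DyadicCube n).toSet ≤ volume U := by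
  obtain ⟨E, hE1, hE2, hE3, hE4⟩ := hS
  rw [← ENNReal.tsum_mul_left]
  calc ∑' Q : T, ENNReal.ofReal η * volume (Q : DyadicCube n).toSet
      ≤ ∑' Q : T, volume (E Q) := ENNReal.tsum_le_tsum fun Q => hE3 Q (hT Q.2)
    _ = volume (⋃ Q ∈ T, E Q) :=
        (measure_biUnion T.to_countable (hE4.subset hT) fun Q hQ => hE1 Q (hT hQ)).symm
    _ ≤ volume U := measure_mono (Set.iUnion₂_subset fun Q hQ => (hE2 Q (hT hQ)).trans (hU Q hQ))

/-- The cubes remaining after `j` layers have total volume `R j` with `η R j ≤ R j - R (j + 1)`,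
whence the geometric decay. -/
theorem tsum_volume_remainingCubes_le (hn : 1 ≤ n) {η : ℝ} (hη0 : 0 < η) (hη1 : η < 1)
    (hS : IsSparseFamily η G) (hG : ∀ Q ∈ G, Q.toSet ⊆ (DyadicCube.unit n).toSet) (j : ℕ) :
    ∑' Q : remainingCubes G j, volume (Q : DyadicCube n).toSet
      ≤ ENNReal.ofReal ((1 - η) ^ j / η) := by
  induction j with
  | zero =>
    have h := ofReal_mul_tsum_volume_le hS (remainingCubes_subset G 0)
      (fun Q hQ => hG Q (remainingCubes_subset G 0 hQ))
    rw [DyadicCube.volume_unit, mul_comm] at h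
    rw [pow_zero, ENNReal.ofReal_div_of_pos hη0, ENNReal.ofReal_one]
    rwa [ENNReal.le_div_iff_mul_le (Or.inl (by simpa using hη0)) (Or.inl ENNReal.ofReal_ne_top)]
  | succ j ih =>
    set R := ∑' Q : remainingCubes G j, volume (Q : DyadicCube n).toSet with hR
    set R' := ∑' Q : remainingCubes G (j + 1), volume (Q : DyadicCube n).toSet with hR'
    set a := ∑' Q : layer G j, volume (Q : DyadicCube n).toSet with ha
    have hsum : R = a + R' := by
      rw [hR, ← remainingCubes_succ_union_layer G j]
      exact Summable.tsum_union_disjoint (f := fun Q : DyadicCube n => volume Q.toSet)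
        (disjoint_layer_remainingCubes_succ G j) ENNReal.summable ENNReal.summable
    have hle : ENNReal.ofReal η * R ≤ a := by
      have h := ofReal_mul_tsum_volume_le hS (remainingCubes_subset G j)
        (U := ⋃ Q ∈ layer G j, Q.toSet) (fun Q hQ => by
          obtain ⟨Q', hQ', hsub⟩ := exists_mem_layer_superset hn hG hQ
          exact hsub.trans (Set.subset_biUnion_of_mem (u := DyadicCube.toSet) hQ'))
      rwa [measure_biUnion (layer G j).to_countable (pairwiseDisjoint_layer hn G j)
        fun Q _ => Q.measurableSet_toSet] at h
    have hRtop : R ≠ ⊤ := (ih.trans_lt ENNReal.ofReal_lt_top).ne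
    have hatop : a ≠ ⊤ := fun h => hRtop (by rw [hsum, h, top_add])
    have hR'top : R' ≠ ⊤ := fun h => hRtop (by rw [hsum, h, add_top])
    have hsum' : R.toReal = a.toReal + R'.toReal := by
      rw [hsum, ENNReal.toReal_add hatop hR'top]
    have hle' : η * R.toReal ≤ a.toReal := by
      have := ENNReal.toReal_mono hatop hle
      rwa [ENNReal.toReal_mul, ENNReal.toReal_ofReal hη0.le] at this
    have h1 : 0 ≤ 1 - η := by linarith
    have ih' : R.toReal ≤ (1 - η) ^ j / η :=
      ENNReal.toReal_le_of_le_ofReal (by positivity) ih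
    rw [← ENNReal.ofReal_toReal hR'top]
    refine ENNReal.ofReal_le_ofReal ?_
    calc R'.toReal ≤ (1 - η) * R.toReal := by linarith
      _ ≤ (1 - η) * ((1 - η) ^ j / η) := mul_le_mul_of_nonneg_left ih' h1
      _ = (1 - η) ^ (j + 1) / η := by ring

theorem layerScale_le_mul_layerScale_succ {K : ℝ} (hK : familyDegree G ≤ K) (j : ℕ) :
    layerScale G j ≤ ENNReal.ofReal ((2 : ℝ) ^ K) * layerScale G (j + 1) := by
  have hlog : (0 : ℝ) < Real.log 2 := Real.log_pos (by norm_num)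
  have hpos : (0 : ℝ) < 2 ^ K := by positivity
  have h1 := (le_iSup (fun j : ℕ => ENNReal.log (layerScale G j / layerScale G (j + 1)) /
    ((Real.log 2 : ℝ) : EReal)) j).trans hK
  rw [EReal.div_le_iff_le_mul (by exact_mod_cast hlog) (EReal.coe_ne_top _)] at h1
  have h2 : ENNReal.log (ENNReal.ofReal ((2 : ℝ) ^ K)) =
      ((Real.log 2 : ℝ) : EReal) * (K : EReal) := by
    rw [ENNReal.log_ofReal_of_pos hpos, Real.log_rpow (by norm_num)]
    norm_cast
    ring
  rw [← h2, ENNReal.log_le_log_iff] at h1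
  rwa [ENNReal.div_le_iff_le_mul (Or.inr ENNReal.ofReal_ne_top) (Or.inr (by simpa using hpos))]
    at h1

/-- Cubes of the `j`-th layer have side length at least `2 ^ (-K j)`. -/
theorem one_le_rpow_pow_mul_sideLength {K : ℝ} (hG : IsGradedFamily G) (hK : familyDegree G ≤ K)
    {j : ℕ} {Q : DyadicCube n} (hQ : Q ∈ layer G j) :
    1 ≤ ((2 : ℝ) ^ K) ^ j * Q.sideLength := by
  have h : ∀ j : ℕ, 1 ≤ ENNReal.ofReal (((2 : ℝ) ^ K) ^ j) * layerScale G j := by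
    intro j
    induction j with
    | zero => simp [layerScale, hG.layer_zero, DyadicCube.sideLength, DyadicCube.unit]
    | succ j ih =>
      refine ih.trans ?_
      rw [pow_succ, ENNReal.ofReal_mul (by positivity), mul_assoc]
      exact mul_le_mul_right (layerScale_le_mul_layerScale_succ hK j) _
  have h1 : layerScale G j ≤ ENNReal.ofReal Q.sideLength := iInf₂_le Q hQ
  have h2 := (h j).trans (mul_le_mul_right h1 _)
  rw [← ENNReal.ofReal_mul (by positivity)] at h2
  simpa using h2

end Layers

/-! ### Weak bounds and integrals -/

section WeakBounds

/-- A bound that is linear in `N` need only be checked for finite positive majorants of `N`. -/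
theorem le_mul_of_forall_pos_le_mul {X N : ℝ≥0∞} {C : ℝ≥0} (hC : 0 < C)
    (h : ∀ N' : ℝ≥0, 0 < N' → N ≤ N' → X ≤ C * N') : X ≤ C * N := by
  have hC0 : (C : ℝ≥0∞) ≠ 0 := by exact_mod_cast hC.ne'
  rw [mul_comm, ← ENNReal.div_le_iff hC0 ENNReal.coe_ne_top]
  refine le_of_forall_gt_imp_ge_of_dense fun N' hN' => ?_
  rw [ENNReal.div_le_iff hC0 ENNReal.coe_ne_top, mul_comm]
  by_cases hN'top : N' = ⊤
  · rw [hN'top, ENNReal.mul_top hC0]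
    exact le_top
  lift N' to ℝ≥0 using hN'top
  exact h N' (by exact_mod_cast zero_le.trans_lt hN') hN'.le

variable {α : Type*}

/-- Dyadic decomposition of the values of `h` above `τ`. -/
theorem le_add_tsum_indicator {τ : ℝ≥0} (hτ : 0 < τ) (h : α → ℝ≥0∞) (x : α) :
    h x ≤ τ + ∑' k : ℕ, {x | ((2 ^ k * τ : ℝ≥0) : ℝ≥0∞) < h x}.indicator
      (fun _ => ((2 ^ (k + 1) * τ : ℝ≥0) : ℝ≥0∞)) x := by
  classical
  by_cases hex : ∃ k : ℕ, h x ≤ ((2 ^ k * τ : ℝ≥0) : ℝ≥0∞)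
  · rcases hk : Nat.find hex with _ | j
    · have := Nat.find_spec hex
      rw [hk, pow_zero, one_mul] at this
      exact this.trans le_self_add
    · have h1 := Nat.find_spec hex
      rw [hk] at h1
      have h2 : ((2 ^ j * τ : ℝ≥0) : ℝ≥0∞) < h x :=
        not_le.1 (Nat.find_min hex (m := j) (by omega))
      refine h1.trans (le_trans ?_ le_add_self)
      refine le_trans ?_ (ENNReal.le_tsum j)
      rw [Set.indicator_of_mem (by exact h2)]
  · push Not at hex
    -- all terms of the series are present, and they are bounded below
    refine le_trans le_top (le_trans (top_le_iff.2 ?_) le_add_self)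
    rw [← top_le_iff, ← ENNReal.tsum_const_eq_top_of_ne_zero (α := ℕ)
      (c := (τ : ℝ≥0∞)) (by exact_mod_cast hτ.ne')]
    refine ENNReal.tsum_le_tsum fun k => ?_
    rw [Set.indicator_of_mem (by exact hex k)]
    exact ENNReal.coe_le_coe.2 (le_mul_of_one_le_left hτ.le (one_le_pow₀ one_le_two))

variable [MeasurableSpace α]

/-- `h` has weak `L^p` quasi-norm at most `N`, where `a = 1 / p`. The exponent `a = 0` stands for
`p = ∞`: then the condition says that `h ≤ N` almost everywhere. -/
def HasWeakBound (ν : Measure α) (h : α → ℝ≥0∞) (a : ℝ) (N : ℝ≥0∞) : Prop :=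
  ∀ s : ℝ≥0, ν {x | (s : ℝ≥0∞) < h x} ≠ 0 → (s : ℝ≥0∞) * ν {x | (s : ℝ≥0∞) < h x} ^ a ≤ N

theorem HasWeakBound.mono {ν : Measure α} {h : α → ℝ≥0∞} {a : ℝ} {N N' : ℝ≥0∞}
    (H : HasWeakBound ν h a N) (hN : N ≤ N') : HasWeakBound ν h a N' :=
  fun s hs => (H s hs).trans hN

theorem HasWeakBound.mono_measure {ν ν' : Measure α} {h : α → ℝ≥0∞} {a : ℝ} {N : ℝ≥0∞}
    (ha : 0 ≤ a) (H : HasWeakBound ν h a N) (hν : ν' ≤ ν) : HasWeakBound ν' h a N := by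
  intro s hs
  have h1 := hν {x | (s : ℝ≥0∞) < h x}
  refine le_trans ?_ (H s fun h0 => hs (le_antisymm (h0 ▸ h1) (zero_le)))
  gcongr

theorem exists_lintegral_le_of_hasWeakBound_of_pos {a : ℝ} (ha0 : 0 < a) (ha1 : a < 1) :
    ∃ C : ℝ≥0, ∀ (ν : Measure α) (h : α → ℝ≥0∞) (m N : ℝ≥0), AEMeasurable h ν → 0 < m → 0 < N →
      ν univ ≤ m → HasWeakBound ν h a N → ∫⁻ x, h x ∂ν ≤ (C * m ^ (1 - a) * N : ℝ≥0) := by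
  set r : ℝ≥0 := 2 ^ (-(1 / a)) with hr
  have h2r : 2 * r < 1 := by
    have h1 : r < 2 ^ (-1 : ℝ) := by
      refine NNReal.rpow_lt_rpow_of_exponent_lt (by norm_num) ?_
      have : 1 < 1 / a := by rw [lt_div_iff₀ ha0]; linarith
      linarith
    rw [NNReal.rpow_neg_one] at h1
    calc 2 * r < 2 * 2⁻¹ := by gcongr
      _ = 1 := by norm_num
  have hra : r ^ a = 2⁻¹ := by
    rw [hr, ← NNReal.rpow_mul, ← NNReal.rpow_neg_one]
    congr 1
    field_simp
  refine ⟨1 + 2 * (1 - 2 * r)⁻¹, fun ν h m N hh hm hN hνm H => ?_⟩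
  set τ : ℝ≥0 := N * m ^ (-a) with hτ
  have hτ0 : 0 < τ := mul_pos hN (NNReal.rpow_pos hm)
  have hτm : τ * m = m ^ (1 - a) * N := by
    rw [hτ, NNReal.rpow_sub hm.ne', NNReal.rpow_one, NNReal.rpow_neg]
    field_simp
  -- the distribution function of `h` decays geometrically along `2 ^ k τ`
  have hdist : ∀ k : ℕ, ν {x | ((2 ^ k * τ : ℝ≥0) : ℝ≥0∞) < h x} ≤ (m * r ^ k : ℝ≥0) := by
    intro k
    have hHk := H (2 ^ k * τ)
    generalize hv : ν {x | ((2 ^ k * τ : ℝ≥0) : ℝ≥0∞) < h x} = v at hHk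
    by_cases hv0 : v = 0
    · rw [hv0]; exact zero_le
    have hvm : v ≤ m := hv ▸ (measure_mono (Set.subset_univ _)).trans hνm
    have hvtop : v ≠ ⊤ := ne_top_of_le_ne_top ENNReal.coe_ne_top hvm
    have hH := hHk hv0
    lift v to ℝ≥0 using hvtop
    rw [← ENNReal.coe_rpow_of_nonneg _ ha0.le, ← ENNReal.coe_mul, ENNReal.coe_le_coe] at hH
    rw [ENNReal.coe_le_coe, ← NNReal.rpow_le_rpow_iff ha0]
    have hkey : (2 ^ k * τ) * (m * r ^ k) ^ a = N := by
      rw [NNReal.mul_rpow, ← NNReal.rpow_natCast r, ← NNReal.rpow_mul, mul_comm (k : ℝ) a,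
        NNReal.rpow_mul, hra, NNReal.rpow_natCast, hτ, NNReal.rpow_neg]
      field_simp
      rw [← mul_pow]
      norm_num
    refine le_of_mul_le_mul_left (hH.trans hkey.ge) ?_
    positivity
  have hmeas : ∀ k : ℕ, NullMeasurableSet {x | ((2 ^ k * τ : ℝ≥0) : ℝ≥0∞) < h x} ν :=
    fun k => nullMeasurableSet_lt aemeasurable_const hh
  calc ∫⁻ x, h x ∂ν
      ≤ ∫⁻ x, (τ + ∑' k : ℕ, {x | ((2 ^ k * τ : ℝ≥0) : ℝ≥0∞) < h x}.indicator
          (fun _ => ((2 ^ (k + 1) * τ : ℝ≥0) : ℝ≥0∞)) x) ∂ν :=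
        lintegral_mono fun x => le_add_tsum_indicator hτ0 h x
    _ = τ * ν univ + ∑' k : ℕ, ((2 ^ (k + 1) * τ : ℝ≥0) : ℝ≥0∞) *
          ν {x | ((2 ^ k * τ : ℝ≥0) : ℝ≥0∞) < h x} := by
        rw [lintegral_add_left measurable_const, lintegral_const, lintegral_tsum]
        · congr 2 with k
          rw [lintegral_indicator_const₀ (hmeas k)]
        · exact fun k => aemeasurable_const.indicator₀ (hmeas k)
    _ ≤ τ * m + ∑' k : ℕ, ((2 ^ (k + 1) * τ : ℝ≥0) : ℝ≥0∞) * (m * r ^ k : ℝ≥0) := by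
        gcongr with k
        exact hdist k
    _ = τ * m + ∑' k : ℕ, ((2 * τ * m : ℝ≥0) : ℝ≥0∞) * ((2 * r : ℝ≥0) : ℝ≥0∞) ^ k := by
        congr 2 with k
        push_cast
        ring
    _ = ((1 + 2 * (1 - 2 * r)⁻¹) * m ^ (1 - a) * N : ℝ≥0) := by
        rw [ENNReal.tsum_mul_left, ENNReal.tsum_geometric, mul_assoc _ _ N, ← hτm,
          ← ENNReal.coe_one, ← ENNReal.coe_sub, ← ENNReal.coe_inv (tsub_pos_of_lt h2r).ne']
        norm_cast
        ring

/-- On a set of measure `m`, weak `L^{1/a}` embeds into `L^1` when `a < 1`, with norm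
`O(m ^ (1 - a))`. -/
theorem exists_lintegral_le_of_hasWeakBound {a : ℝ} (ha0 : 0 ≤ a) (ha1 : a < 1) :
    ∃ C : ℝ≥0, ∀ (ν : Measure α) (h : α → ℝ≥0∞) (m N : ℝ≥0), AEMeasurable h ν → 0 < m → 0 < N →
      ν univ ≤ m → HasWeakBound ν h a N → ∫⁻ x, h x ∂ν ≤ (C * m ^ (1 - a) * N : ℝ≥0) := by
  rcases ha0.eq_or_lt with rfl | ha0
  · -- a bounded function on a set of finite measure lies in weak `L^2`
    obtain ⟨C, hC⟩ := exists_lintegral_le_of_hasWeakBound_of_pos (α := α) (a := 1 / 2)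
      (by norm_num) (by norm_num)
    refine ⟨C, fun ν h m N hh hm hN hνm H => ?_⟩
    have h2 : HasWeakBound ν h (1 / 2) (m ^ (1 / 2 : ℝ) * N : ℝ≥0) := by
      intro s hs
      have h3 := H s hs
      rw [ENNReal.rpow_zero, mul_one] at h3
      rw [ENNReal.coe_mul, ENNReal.coe_rpow_of_nonneg _ (by norm_num), mul_comm]
      gcongr
      exact (measure_mono (Set.subset_univ _)).trans hνm
    refine (hC ν h m _ hh hm (mul_pos (NNReal.rpow_pos hm) hN) hνm h2).trans_eq ?_
    congr 1
    rw [mul_assoc C, ← mul_assoc _ _ N, ← NNReal.rpow_add hm.ne', mul_assoc]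
    norm_num
  · exact exists_lintegral_le_of_hasWeakBound_of_pos ha0 ha1

end WeakBounds

/-! ### Averages over disjoint cubes -/

section Averages

variable {n : ℕ}

/-- The averaging operator of a family of disjoint cubes is self-adjoint and does not increase
the sup norm nor the `L^1` norm. Hence its integral over `F` is the integral of `h` against a
measure dominated by Lebesgue measure and of mass at most `|F|`. -/
theorem exists_setLIntegral_averages_le {a : ℝ} (ha0 : 0 ≤ a) (ha1 : a < 1) :
    ∃ C : ℝ≥0, ∀ (T : Set (DyadicCube n)) (F : Set (Fin n → ℝ)) (h : (Fin n → ℝ) → ℝ≥0∞)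
      (m N : ℝ≥0), T.PairwiseDisjoint DyadicCube.toSet → MeasurableSet F →
      AEMeasurable h volume → 0 < m → 0 < N → volume F ≤ m → HasWeakBound volume h a N →
      ∫⁻ x in F, ∑' Q : T, (Q : DyadicCube n).toSet.indicator (fun _ =>
        (volume (Q : DyadicCube n).toSet)⁻¹ * ∫⁻ y in (Q : DyadicCube n).toSet, h y) x
        ≤ (C * m ^ (1 - a) * N : ℝ≥0) := by
  obtain ⟨C, hC⟩ := exists_lintegral_le_of_hasWeakBound (α := Fin n → ℝ) ha0 ha1
  refine ⟨C, fun T F h m N hT hF hh hm hN hFm H => ?_⟩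
  set g : (Fin n → ℝ) → ℝ≥0∞ := fun x => ∑' Q : T, (Q : DyadicCube n).toSet.indicator (fun _ =>
    (volume (Q : DyadicCube n).toSet)⁻¹ * volume (F ∩ (Q : DyadicCube n).toSet)) x with hg
  have hterm : ∀ Q : T, Measurable ((Q : DyadicCube n).toSet.indicator
      (fun _ : Fin n → ℝ => (volume (Q : DyadicCube n).toSet)⁻¹ *
        volume (F ∩ (Q : DyadicCube n).toSet))) := fun Q =>
    measurable_const.indicator Q.1.measurableSet_toSet
  have hgm : Measurable g := Measurable.tsum hterm
  have hg1 : ∀ x, g x ≤ 1 := by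
    intro x
    by_cases hx : ∃ Q : T, x ∈ (Q : DyadicCube n).toSet
    · obtain ⟨Q, hQ⟩ := hx
      rw [hg]
      dsimp only
      rw [tsum_eq_single Q, Set.indicator_of_mem hQ]
      · rw [mul_comm, ← div_eq_mul_inv]
        exact ENNReal.div_le_of_le_mul (by
          rw [one_mul]; exact measure_mono Set.inter_subset_right)
      · intro Q' hne
        refine Set.indicator_of_notMem (fun hQ' => ?_) _
        exact Set.disjoint_left.1 (hT Q'.2 Q.2 fun h => hne (Subtype.ext h)) hQ' hQ
    · push Not at hx
      have : g x = 0 := ENNReal.tsum_eq_zero.2 fun Q => Set.indicator_of_notMem (hx Q) _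
      rw [this]
      exact zero_le
  have hνle : volume.withDensity g ≤ (volume : Measure (Fin n → ℝ)) := by
    calc volume.withDensity g ≤ volume.withDensity 1 := withDensity_mono (ae_of_all _ hg1)
      _ = volume := withDensity_one
  have hνm : volume.withDensity g univ ≤ m := by
    refine le_trans ?_ hFm
    rw [withDensity_apply _ MeasurableSet.univ, Measure.restrict_univ, hg,
      lintegral_tsum fun Q => (hterm Q).aemeasurable]
    calc ∑' Q : T, ∫⁻ x, (Q : DyadicCube n).toSet.indicator (fun _ =>
          (volume (Q : DyadicCube n).toSet)⁻¹ * volume (F ∩ (Q : DyadicCube n).toSet)) x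
        = ∑' Q : T, volume (F ∩ (Q : DyadicCube n).toSet) := by
          congr 1 with Q
          rw [lintegral_indicator_const Q.1.measurableSet_toSet, mul_comm, ← mul_assoc,
            ENNReal.mul_inv_cancel Q.1.volume_toSet_ne_zero Q.1.volume_toSet_ne_top, one_mul]
      _ = volume (⋃ Q ∈ T, F ∩ Q.toSet) :=
          (measure_biUnion T.to_countable
            (fun Q hQ Q' hQ' hne => (hT hQ hQ' hne).mono Set.inter_subset_right
              Set.inter_subset_right) fun Q _ => hF.inter Q.measurableSet_toSet).symm
      _ ≤ volume F := measure_mono (Set.iUnion₂_subset fun _ _ => Set.inter_subset_left)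
  refine le_trans (le_of_eq ?_) (hC (volume.withDensity g) h m N
    (hh.mono_ac (withDensity_absolutelyContinuous _ _)) hm hN hνm (H.mono_measure ha0 hνle))
  rw [lintegral_withDensity_eq_lintegral_mul₀ hgm.aemeasurable hh,
    lintegral_tsum fun Q => (measurable_const.indicator Q.1.measurableSet_toSet).aemeasurable]
  simp only [Pi.mul_apply, hg]
  simp_rw [← ENNReal.tsum_mul_right]
  have hterm' : ∀ Q : T, AEMeasurable (fun x => (Q : DyadicCube n).toSet.indicator
      (fun _ => (volume (Q : DyadicCube n).toSet)⁻¹ * volume (F ∩ (Q : DyadicCube n).toSet)) x *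
        h x) volume := fun Q => (hterm Q).aemeasurable.mul hh
  rw [lintegral_tsum hterm']
  congr 1 with Q
  rw [lintegral_indicator_const Q.1.measurableSet_toSet,
    Measure.restrict_apply Q.1.measurableSet_toSet]
  simp_rw [← Set.indicator_mul_left]
  rw [lintegral_indicator Q.1.measurableSet_toSet, lintegral_const_mul'' _ hh.restrict,
    Set.inter_comm]
  ring

end Averages

/-! ### The weak-type estimate on the critical line -/

section WeakType

variable {n : ℕ}

theorem measurable_hypersingularSparse (S : Set (DyadicCube n)) (t : ℝ) (f : (Fin n → ℝ) → ℂ) :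
    Measurable (hypersingularSparse S t f) :=
  Measurable.tsum fun Q => measurable_const.indicator Q.1.measurableSet_toSet

theorem hypersingularSparse_eq_zero {S : Set (DyadicCube n)} {U : Set (Fin n → ℝ)}
    (hS : ∀ Q ∈ S, Q.toSet ⊆ U) (t : ℝ) (f : (Fin n → ℝ) → ℂ) {x : Fin n → ℝ} (hx : x ∉ U) :
    hypersingularSparse S t f x = 0 :=
  ENNReal.tsum_eq_zero.2 fun Q => Set.indicator_of_notMem (fun h => hx (hS Q Q.2 h)) _

/-- The hypersingular factor costs `2 ^ (n K (t - 1))` for each layer. -/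
theorem volume_rpow_neg_le {S : Set (DyadicCube n)} {K t : ℝ} (ht : 1 < t)
    (hG : IsGradedFamily S) (hK : familyDegree S ≤ K) {j : ℕ} {Q : DyadicCube n}
    (hQ : Q ∈ layer S j) :
    volume Q.toSet ^ (-t) ≤
      ENNReal.ofReal (((2 : ℝ) ^ (n * K * (t - 1))) ^ j) * (volume Q.toSet)⁻¹ := by
  have hl := Q.sideLength_pos
  have hv : 0 < Q.sideLength ^ n := pow_pos hl n
  rw [Q.volume_toSet, ENNReal.ofReal_rpow_of_pos hv, ← ENNReal.ofReal_inv_of_pos hv,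
    ← ENNReal.ofReal_mul (by positivity)]
  refine ENNReal.ofReal_le_ofReal ?_
  have h1 : 1 ≤ ((((2 : ℝ) ^ K) ^ j * Q.sideLength) ^ n) ^ (t - 1) :=
    Real.one_le_rpow (one_le_pow₀ (one_le_rpow_pow_mul_sideLength hG hK hQ)) (by linarith)
  have h2 : (((((2 : ℝ) ^ K) ^ j) ^ n) ^ (t - 1)) = ((2 : ℝ) ^ (n * K * (t - 1))) ^ j := by
    rw [← Real.rpow_natCast, ← Real.rpow_natCast, ← Real.rpow_natCast,
      ← Real.rpow_mul (by positivity), ← Real.rpow_mul (by positivity),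
      ← Real.rpow_mul (by positivity),
      ← Real.rpow_mul (by positivity)]
    congr 1
    ring
  rw [mul_pow, Real.mul_rpow (by positivity) hv.le, h2] at h1
  have h3 : (Q.sideLength ^ n) ^ (-t) =
      (Q.sideLength ^ n)⁻¹ * ((Q.sideLength ^ n) ^ (t - 1))⁻¹ := by
    rw [← Real.rpow_neg hv.le, ← Real.rpow_neg_one (Q.sideLength ^ n), ← Real.rpow_add hv]
    congr 1
    ring
  have hpos : 0 < (Q.sideLength ^ n) ^ (t - 1) := Real.rpow_pos_of_pos hv _
  rw [h3, mul_comm]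
  refine mul_le_mul_of_nonneg_right ?_ (by positivity)
  rwa [inv_le_iff_one_le_mul₀ hpos]

/-- Off the cubes remaining after `N` layers, only the averages over the first `N` layers
contribute. -/
theorem hypersingularSparse_le_sum_averages {S : Set (DyadicCube n)} {K t : ℝ} (ht : 1 < t)
    (hG : IsGradedFamily S) (hK : familyDegree S ≤ K) (f : (Fin n → ℝ) → ℂ) (N : ℕ)
    {x : Fin n → ℝ} (hx : x ∉ ⋃ Q ∈ remainingCubes S N, Q.toSet) :
    hypersingularSparse S t f x ≤ ∑ j ∈ Finset.range N,
      ENNReal.ofReal (((2 : ℝ) ^ (n * K * (t - 1))) ^ j) *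
        ∑' Q : layer S j, (Q : DyadicCube n).toSet.indicator (fun _ =>
          (volume (Q : DyadicCube n).toSet)⁻¹ * ∫⁻ y in (Q : DyadicCube n).toSet, ‖f y‖ₑ) x := by
  set u : DyadicCube n → ℝ≥0∞ := fun Q => Q.toSet.indicator
    (fun _ => (volume Q.toSet) ^ (-t) * ∫⁻ y in Q.toSet, ‖f y‖ₑ) x with hu
  set w : DyadicCube n → ℝ≥0∞ := fun Q => Q.toSet.indicator
    (fun _ => (volume Q.toSet)⁻¹ * ∫⁻ y in Q.toSet, ‖f y‖ₑ) x with hw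
  set B : ℝ := (2 : ℝ) ^ (n * K * (t - 1)) with hB
  have hpt : ∀ Q, S.indicator u Q ≤
      ∑ j ∈ Finset.range N, (layer S j).indicator (fun Q => ENNReal.ofReal (B ^ j) * w Q) Q := by
    intro Q
    by_cases hQS : Q ∈ S
    · by_cases hxQ : x ∈ Q.toSet
      · have hQN : Q ∉ remainingCubes S N := fun h => hx (Set.mem_biUnion h hxQ)
        obtain ⟨j, hj, hQj⟩ := exists_mem_layer_of_notMem_remainingCubes hQS N hQN
        refine le_trans ?_ (Finset.single_le_sum (fun _ _ => zero_le) (Finset.mem_range.2 hj))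
        rw [Set.indicator_of_mem hQS, Set.indicator_of_mem hQj, hu, hw]
        dsimp only
        rw [Set.indicator_of_mem hxQ, Set.indicator_of_mem hxQ, ← mul_assoc]
        gcongr
        exact volume_rpow_neg_le ht hG hK hQj
      · rw [Set.indicator_of_mem hQS, hu]
        dsimp only
        rw [Set.indicator_of_notMem hxQ]
        exact zero_le
    · rw [Set.indicator_of_notMem hQS]
      exact zero_le
  calc hypersingularSparse S t f x = ∑' Q : S, u Q := rfl
    _ = ∑' Q, S.indicator u Q := tsum_subtype S u
    _ ≤ ∑' Q, ∑ j ∈ Finset.range N,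
          (layer S j).indicator (fun Q => ENNReal.ofReal (B ^ j) * w Q) Q :=
        ENNReal.tsum_le_tsum hpt
    _ = ∑ j ∈ Finset.range N, ENNReal.ofReal (B ^ j) * ∑' Q : layer S j, w Q := by
        rw [Summable.tsum_finsetSum fun _ _ => ENNReal.summable]
        refine Finset.sum_congr rfl fun j _ => ?_
        rw [← ENNReal.tsum_mul_left, ← tsum_subtype (layer S j)]

theorem volume_iUnion_remainingCubes_le (hn : 1 ≤ n) {η : ℝ} (hη0 : 0 < η) (hη1 : η < 1)
    {S : Set (DyadicCube n)} (hS : IsSparseFamily η S)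
    (hG : ∀ Q ∈ S, Q.toSet ⊆ (DyadicCube.unit n).toSet) (j : ℕ) :
    volume (⋃ Q ∈ remainingCubes S j, Q.toSet) ≤ ENNReal.ofReal ((1 - η) ^ j / η) :=
  (measure_biUnion_le volume (remainingCubes S j).to_countable _).trans
    (tsum_volume_remainingCubes_le hn hη0 hη1 hS hG j)

theorem rpow_eq_one_sub_rpow_neg {η M : ℝ} (hη0 : 0 < η) (hη1 : η < 1) :
    (2 : ℝ) ^ M = (1 - η) ^ (-(M / (-Real.logb 2 (1 - η)))) := by
  have hD : 0 < 1 - η := by linarith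
  have hlog : Real.logb 2 (1 - η) < 0 := Real.logb_neg (by norm_num) hD (by linarith)
  have hpow : (2 : ℝ) ^ Real.logb 2 (1 - η) = 1 - η :=
    Real.rpow_logb (by norm_num) (by norm_num) hD
  generalize Real.logb 2 (1 - η) = l at hlog hpow ⊢
  rw [← hpow, ← Real.rpow_mul (by norm_num)]
  congr 1
  field_simp [hlog.ne]

/-- The weak-type estimate on the critical line, for a finite positive bound of the weak norm. -/
theorem exists_weak_type_bound_of_pos (hn : 1 ≤ n) {η K t : ℝ} (hη0 : 0 < η) (hη1 : η < 1)
    (hK : 0 < K) (ht : 1 < t) {a : ℝ} (ha0 : 0 ≤ a) (ha1 : a < 1) :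
    ∃ C : ℝ≥0, 0 < C ∧ ∀ S : Set (DyadicCube n), IsSparseFamily η S → IsGradedFamily S →
      familyDegree S ≤ K → ∀ f : (Fin n → ℝ) → ℂ, AEStronglyMeasurable f volume →
      ∀ N : ℝ≥0, 0 < N → HasWeakBound volume (fun x => ‖f x‖ₑ) a N → ∀ s : ℝ≥0,
        (s : ℝ≥0∞) * volume {x | (s : ℝ≥0∞) < hypersingularSparse S t f x} ^
          (a + n * K * (t - 1) / (-Real.logb 2 (1 - η))) ≤ C * N := by
  obtain ⟨C₁, hC₁⟩ := exists_setLIntegral_averages_le (n := n) ha0 ha1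
  have hD : 0 < 1 - η := by linarith
  have hn' : (0 : ℝ) < n := by exact_mod_cast hn
  have hM : 0 < n * K * (t - 1) := mul_pos (mul_pos hn' hK) (by linarith)
  have hL : 0 < -Real.logb 2 (1 - η) := by
    have := Real.logb_neg (b := 2) (by norm_num) hD (by linarith)
    linarith
  have hBθ := rpow_eq_one_sub_rpow_neg (M := n * K * (t - 1)) hη0 hη1
  have hB1 : 1 < (2 : ℝ) ^ (n * K * (t - 1)) := Real.one_lt_rpow (by norm_num) hM
  have hθ : 0 < n * K * (t - 1) / (-Real.logb 2 (1 - η)) := div_pos hM hL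
  set θ : ℝ := n * K * (t - 1) / (-Real.logb 2 (1 - η)) with hθdef
  set B : ℝ := (2 : ℝ) ^ (n * K * (t - 1)) with hB
  set C₂ : ℝ := 2 * (B / (B - 1)) * (η / 2) ^ (-θ) * C₁ with hC₂
  have hB0 : 0 < B - 1 := by linarith
  have hC₂0 : 0 ≤ C₂ := by positivity
  refine ⟨(C₂ + 1).toNNReal, Real.toNNReal_pos.2 (by positivity),
    fun S hS hG hdeg f hf N hN H s => ?_⟩
  set A := hypersingularSparse S t f with hA
  have hAm : Measurable A := measurable_hypersingularSparse S t f
  set F₀ := {x | (s : ℝ≥0∞) < A x} with hF₀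
  have hF₀m : MeasurableSet F₀ := measurableSet_lt measurable_const hAm
  have hF₀1 : volume F₀ ≤ 1 := by
    rw [← DyadicCube.volume_unit (n := n)]
    refine measure_mono fun x hx => ?_
    by_contra hxU
    have := hypersingularSparse_eq_zero hG.subset_unit t f hxU
    rw [hF₀, Set.mem_ofPred_eq, hA, this] at hx
    exact not_lt_zero hx
  by_cases hm0 : volume F₀ = 0
  · rw [hm0, ENNReal.zero_rpow_of_pos (by linarith), mul_zero]
    exact zero_le
  obtain ⟨m, hm⟩ : ∃ m : ℝ≥0, (m : ℝ≥0∞) = volume F₀ :=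
    ⟨_, ENNReal.coe_toNNReal (ne_top_of_le_ne_top ENNReal.one_ne_top hF₀1)⟩
  rw [← hm] at hm0 hF₀1
  have hmpos : 0 < m := pos_iff_ne_zero.2 (by exact_mod_cast hm0)
  have hm1 : m ≤ 1 := by exact_mod_cast hF₀1
  have hmposR : (0 : ℝ) < m := hmpos
  have hm1R : (m : ℝ) ≤ 1 := hm1
  -- the first layer whose remainder covers at most half of the level set
  have hex : ∃ k : ℕ, (1 - η) ^ k / η ≤ m / 2 := by
    obtain ⟨k, hk⟩ := exists_pow_lt_of_lt_one (show (0 : ℝ) < m / 2 * η by positivity)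
      (show 1 - η < 1 by linarith)
    exact ⟨k, by rw [div_le_iff₀ hη0]; exact hk.le⟩
  obtain ⟨j, hj1, hj2⟩ :
      ∃ j : ℕ, (1 - η) ^ (j + 1) / η ≤ m / 2 ∧ (m : ℝ) / 2 < (1 - η) ^ j / η := by
    classical
    have hspec := Nat.find_spec hex
    rcases hk : Nat.find hex with _ | j
    · rw [hk, pow_zero, div_le_iff₀ hη0] at hspec
      nlinarith
    · refine ⟨j, by rwa [hk] at hspec, not_le.1 (Nat.find_min hex (m := j) (by omega))⟩
  set V := ⋃ Q ∈ remainingCubes S (j + 1), Q.toSet with hV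
  have hVle : volume V ≤ ENNReal.ofReal (m / 2) :=
    (volume_iUnion_remainingCubes_le hn hη0 hη1 hS hG.subset_unit (j + 1)).trans
      (ENNReal.ofReal_le_ofReal hj1)
  have hVm : MeasurableSet V := MeasurableSet.biUnion (Set.to_countable _)
    fun Q _ => Q.measurableSet_toSet
  have hFle : volume (F₀ \ V) ≤ m := hm ▸ measure_mono Set.sdiff_subset
  have hFge : ENNReal.ofReal (m / 2) ≤ volume (F₀ \ V) := by
    refine le_trans ?_ (le_measure_sdiff (s₁ := F₀) (s₂ := V))
    rw [← hm]
    refine le_trans ?_ (tsub_le_tsub_left hVle _)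
    rw [← ENNReal.ofReal_coe_nnreal, ← ENNReal.ofReal_sub _ (by positivity)]
    exact ENNReal.ofReal_le_ofReal (by linarith)
  have hFm : MeasurableSet (F₀ \ V) := hF₀m.diff hVm
  have hmain : ENNReal.ofReal (s * (m / 2)) ≤
      ENNReal.ofReal (∑ i ∈ Finset.range (j + 1), B ^ i * (C₁ * m ^ (1 - a) * N)) := by
    calc ENNReal.ofReal (s * (m / 2))
        = s * ENNReal.ofReal (m / 2) := by
          rw [ENNReal.ofReal_mul (NNReal.coe_nonneg s), ENNReal.ofReal_coe_nnreal]
      _ ≤ s * volume (F₀ \ V) := by gcongr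
      _ = ∫⁻ x in F₀ \ V, s := by rw [setLIntegral_const]
      _ ≤ ∫⁻ x in F₀ \ V, ∑ i ∈ Finset.range (j + 1), ENNReal.ofReal (B ^ i) *
            ∑' Q : layer S i, (Q : DyadicCube n).toSet.indicator (fun _ =>
              (volume (Q : DyadicCube n).toSet)⁻¹ *
                ∫⁻ y in (Q : DyadicCube n).toSet, ‖f y‖ₑ) x := by
          refine setLIntegral_mono' hFm fun x hx => ?_
          exact hx.1.le.trans (hypersingularSparse_le_sum_averages ht hG hdeg f _ hx.2)
      _ = ∑ i ∈ Finset.range (j + 1), ENNReal.ofReal (B ^ i) * ∫⁻ x in F₀ \ V,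
            ∑' Q : layer S i, (Q : DyadicCube n).toSet.indicator (fun _ =>
              (volume (Q : DyadicCube n).toSet)⁻¹ *
                ∫⁻ y in (Q : DyadicCube n).toSet, ‖f y‖ₑ) x := by
          have hmeas : ∀ i : ℕ, Measurable fun x => ∑' Q : layer S i,
              (Q : DyadicCube n).toSet.indicator (fun _ => (volume (Q : DyadicCube n).toSet)⁻¹ *
                ∫⁻ y in (Q : DyadicCube n).toSet, ‖f y‖ₑ) x := fun i =>
            Measurable.tsum fun Q => measurable_const.indicator Q.1.measurableSet_toSet
          rw [lintegral_finsetSum _ fun i _ => (hmeas i).const_mul _]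
          exact Finset.sum_congr rfl fun i _ => lintegral_const_mul _ (hmeas i)
      _ ≤ ∑ i ∈ Finset.range (j + 1),
            ENNReal.ofReal (B ^ i) * (C₁ * m ^ (1 - a) * N : ℝ≥0) := by
          gcongr with i hi
          exact hC₁ (layer S i) (F₀ \ V) _ m N (pairwiseDisjoint_layer hn S i) hFm hf.enorm hmpos
            hN hFle H
      _ = ENNReal.ofReal (∑ i ∈ Finset.range (j + 1), B ^ i * (C₁ * m ^ (1 - a) * N)) := by
          rw [ENNReal.ofReal_sum_of_nonneg fun i _ => by positivity]
          refine Finset.sum_congr rfl fun i _ => ?_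
          rw [ENNReal.ofReal_mul (by positivity)]
          congr 1
          rw [← ENNReal.ofReal_coe_nnreal]
          simp
  rw [ENNReal.ofReal_le_ofReal_iff (Finset.sum_nonneg fun i _ => by positivity),
    ← Finset.sum_mul, geom_sum_eq hB1.ne'] at hmain
  -- `B ^ j = ((1 - η) ^ j) ^ (-θ)`, and `(1 - η) ^ j` is comparable to `m`
  have hBj : B ^ j ≤ (η / 2) ^ (-θ) * (m : ℝ) ^ (-θ) := by
    have h1 : B ^ j = ((1 - η) ^ j) ^ (-θ) := by
      rw [hBθ, ← Real.rpow_natCast, ← Real.rpow_natCast, ← Real.rpow_mul hD.le,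
        ← Real.rpow_mul hD.le, mul_comm]
    rw [h1, ← Real.mul_rpow (by positivity) hmposR.le]
    refine Real.rpow_le_rpow_of_nonpos (by positivity) ?_ (by linarith)
    rw [lt_div_iff₀ hη0] at hj2
    linarith
  have hsum : (B ^ (j + 1) - 1) / (B - 1) ≤
      B / (B - 1) * ((η / 2) ^ (-θ) * (m : ℝ) ^ (-θ)) := by
    rw [div_mul_eq_mul_div]
    gcongr
    rw [pow_succ, mul_comm]
    have := mul_le_mul_of_nonneg_left hBj (show 0 ≤ B by linarith)
    linarith
  have hs : (s : ℝ) * m ≤ C₂ * N * (m : ℝ) ^ (1 - a - θ) := by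
    have h1 := hmain.trans (mul_le_mul_of_nonneg_right hsum
      (show (0 : ℝ) ≤ C₁ * m ^ (1 - a) * N by positivity))
    have h2 : (m : ℝ) ^ (1 - a - θ) = (m : ℝ) ^ (1 - a) * (m : ℝ) ^ (-θ) := by
      rw [← Real.rpow_add hmposR]; congr 1
    rw [h2, hC₂]
    linarith
  have hfinal : (s : ℝ) * (m : ℝ) ^ (a + θ) ≤ (C₂ + 1) * N := by
    have h1 := mul_le_mul_of_nonneg_right hs (Real.rpow_nonneg hmposR.le (a + θ - 1))
    have h2 : (m : ℝ) ^ (1 - a - θ) * (m : ℝ) ^ (a + θ - 1) = 1 := by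
      rw [← Real.rpow_add hmposR]
      have : 1 - a - θ + (a + θ - 1) = 0 := by ring
      rw [this, Real.rpow_zero]
    have h3 : (m : ℝ) * (m : ℝ) ^ (a + θ - 1) = (m : ℝ) ^ (a + θ) := by
      rw [← Real.rpow_one_add' hmposR.le (by linarith)]
      congr 1
      ring
    rw [mul_assoc, h3, mul_assoc, h2, mul_one] at h1
    have : (0 : ℝ) ≤ N := N.coe_nonneg
    linarith
  rw [← hm, ← ENNReal.coe_rpow_of_nonneg _ (by linarith), ← ENNReal.coe_mul, ← ENNReal.coe_mul,
    ENNReal.coe_le_coe, ← NNReal.coe_le_coe]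
  push_cast
  rw [Real.coe_toNNReal _ (by positivity)]
  exact hfinal

/-- The weak-type estimate on the critical line: weak `L^{1/a}` is mapped into weak `L^{1/b}`,
where `b - a` is the critical exponent. -/
theorem exists_weak_type_bound (hn : 1 ≤ n) {η K t : ℝ} (hη0 : 0 < η) (hη1 : η < 1)
    (hK : 0 < K) (ht : 1 < t) {a : ℝ} (ha0 : 0 ≤ a) (ha1 : a < 1) :
    ∃ C : ℝ≥0, ∀ S : Set (DyadicCube n), IsSparseFamily η S → IsGradedFamily S →
      familyDegree S ≤ K → ∀ f : (Fin n → ℝ) → ℂ, AEStronglyMeasurable f volume →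
      ∀ N : ℝ≥0∞, HasWeakBound volume (fun x => ‖f x‖ₑ) a N → ∀ s : ℝ≥0,
        (s : ℝ≥0∞) * volume {x | (s : ℝ≥0∞) < hypersingularSparse S t f x} ^
          (a + n * K * (t - 1) / (-Real.logb 2 (1 - η))) ≤ C * N := by
  obtain ⟨C, hC0, hC⟩ := exists_weak_type_bound_of_pos hn hη0 hη1 hK ht ha0 ha1
  exact ⟨C, fun S hS hG hdeg f hf N H s => le_mul_of_forall_pos_le_mul hC0 fun N' hN' hle =>
    hC S hS hG hdeg f hf N' hN' (H.mono hle) s⟩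

end WeakType

/-! ### Comparison of norms -/

section Norms

variable {n : ℕ}

theorem hasWeakBound_weakLpNorm {E : Type*} [ENorm E] (g : (Fin n → ℝ) → E) {p : ℝ≥0∞} :
    HasWeakBound volume (fun x => ‖g x‖ₑ) (p⁻¹).toReal (weakLpNorm g p) := by
  intro s hs
  by_cases hp : p = ⊤
  · subst hp
    rw [weakLpNorm, if_pos rfl, ENNReal.inv_top, ENNReal.toReal_zero, ENNReal.rpow_zero, mul_one]
    by_contra hlt
    refine hs (measure_mono_null ?_ (meas_eLpNormEssSup_lt (f := g) (μ := volume)))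
    exact fun x hx => (not_le.1 hlt).trans hx
  · rw [weakLpNorm, if_neg hp, ENNReal.toReal_inv, ← one_div]
    exact le_iSup (fun s : ℝ≥0 => (s : ℝ≥0∞) *
      volume {x | (s : ℝ≥0∞) < ‖g x‖ₑ} ^ (1 / p.toReal)) s

theorem weakLpNorm_le_eLpNorm {f : (Fin n → ℝ) → ℂ} (hf : AEStronglyMeasurable f volume)
    {p : ℝ≥0∞} (hp0 : p ≠ 0) : weakLpNorm f p ≤ eLpNorm f p volume := by
  by_cases hp : p = ⊤
  · rw [weakLpNorm, if_pos hp, hp, eLpNorm_exponent_top]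
  · rw [weakLpNorm, if_neg hp]
    refine iSup_le fun s => ?_
    have hp' : 0 < p.toReal := ENNReal.toReal_pos hp0 hp
    refine le_trans ?_ (pow_mul_meas_ge_le_eLpNorm volume hp0 hp hf ((s : ℝ≥0∞) ^ p.toReal))
    rw [ENNReal.mul_rpow_of_nonneg _ _ (by positivity), ← ENNReal.rpow_mul,
      mul_one_div_cancel hp'.ne', ENNReal.rpow_one]
    refine mul_le_mul_right (ENNReal.rpow_le_rpow (measure_mono fun x hx => ?_) (by positivity)) _
    exact ENNReal.rpow_le_rpow (le_of_lt hx) hp'.le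

/-- The distribution function is nonincreasing, so `s |{|f| > s}|^(1/p)` is at most its integral
over `(0, s)`. -/
theorem weakLpNorm_le_lorentzOneNorm (f : (Fin n → ℝ) → ℂ) {p : ℝ} (hp : 1 ≤ p) :
    weakLpNorm f (ENNReal.ofReal p) ≤ lorentzOneNorm f p := by
  rw [weakLpNorm, if_neg ENNReal.ofReal_ne_top, ENNReal.toReal_ofReal (by linarith),
    lorentzOneNorm]
  refine iSup_le fun s => ?_
  refine le_trans ?_ (le_mul_of_one_le_left' (by simpa using hp))
  calc (s : ℝ≥0∞) * volume {x | (s : ℝ≥0∞) < ‖f x‖ₑ} ^ (1 / p)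
      = ∫⁻ u in Set.Ioo (0 : ℝ) s, volume {x | (s : ℝ≥0∞) < ‖f x‖ₑ} ^ (1 / p) := by
        rw [setLIntegral_const, Real.volume_Ioo, sub_zero, ENNReal.ofReal_coe_nnreal, mul_comm]
    _ ≤ ∫⁻ u in Set.Ioo (0 : ℝ) s, volume {x | ENNReal.ofReal u < ‖f x‖ₑ} ^ (1 / p) := by
        refine setLIntegral_mono' measurableSet_Ioo fun u hu => ?_
        gcongr with x
        rw [← ENNReal.ofReal_coe_nnreal]
        exact ENNReal.ofReal_le_ofReal hu.2.le
    _ ≤ ∫⁻ u in Set.Ioi (0 : ℝ), volume {x | ENNReal.ofReal u < ‖f x‖ₑ} ^ (1 / p) :=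
        lintegral_mono_set Set.Ioo_subset_Ioi_self

/-- A function that is in weak `L^{1/b}` and vanishes off a set of measure at most one is in
`L^q` for `q < 1/b`. -/
theorem exists_eLpNorm_le_of_weak {b : ℝ} (hb : 0 < b) {q : ℝ≥0∞} (hq0 : q ≠ 0)
    (hqb : b < (q⁻¹).toReal) :
    ∃ C : ℝ≥0, ∀ (A : (Fin n → ℝ) → ℝ≥0∞) (U : Set (Fin n → ℝ)) (N : ℝ≥0∞), Measurable A →
      MeasurableSet U → volume U ≤ 1 → (∀ x ∉ U, A x = 0) →
      (∀ s : ℝ≥0, (s : ℝ≥0∞) * volume {x | (s : ℝ≥0∞) < A x} ^ b ≤ N) →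
      eLpNorm A q volume ≤ C * N := by
  have hqtop : q ≠ ⊤ := by
    rintro rfl
    simp only [ENNReal.inv_top, ENNReal.toReal_zero] at hqb
    linarith
  have hr : 0 < q.toReal := ENNReal.toReal_pos hq0 hqtop
  rw [ENNReal.toReal_inv] at hqb
  set r := q.toReal with hrdef
  have hbr : b * r < 1 := by
    calc b * r < r⁻¹ * r := by gcongr
      _ = 1 := inv_mul_cancel₀ hr.ne'
  obtain ⟨C, hC⟩ := exists_lintegral_le_of_hasWeakBound (α := Fin n → ℝ) (a := b * r)
    (by positivity) hbr
  refine ⟨C ^ (1 / r) + 1, fun A U N₀ hA hU hU1 hAU H₀ =>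
    le_mul_of_forall_pos_le_mul (by positivity) fun N hN hN₀ => ?_⟩
  have H := fun s => (H₀ s).trans hN₀
  have hweak : HasWeakBound volume (fun x => A x ^ r) (b * r) (N ^ r : ℝ≥0) := by
    intro s _
    have h1 := ENNReal.rpow_le_rpow (H (s ^ (1 / r))) hr.le
    have hset : {x | ((s ^ (1 / r) : ℝ≥0) : ℝ≥0∞) < A x} = {x | (s : ℝ≥0∞) < A x ^ r} := by
      ext x
      simp only [Set.mem_ofPred_eq]
      rw [ENNReal.coe_rpow_of_nonneg _ (by positivity), one_div, ENNReal.rpow_inv_lt_iff hr]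
    rw [hset, ENNReal.mul_rpow_of_nonneg _ _ hr.le, ← ENNReal.rpow_mul,
      ← ENNReal.coe_rpow_of_nonneg _ hr.le, ← ENNReal.coe_rpow_of_nonneg _ hr.le,
      ← NNReal.rpow_mul, one_div_mul_cancel hr.ne', NNReal.rpow_one] at h1
    exact h1
  have h2 := hC (volume.restrict U) (fun x => A x ^ r) 1 (N ^ r) (hA.pow_const r).aemeasurable
    one_pos (NNReal.rpow_pos hN) (by simpa using hU1)
    (hweak.mono_measure (by positivity) Measure.restrict_le_self)
  have hsupp : ∫⁻ x, A x ^ r = ∫⁻ x in U, A x ^ r := by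
    rw [← lintegral_indicator hU]
    congr 1 with x
    by_cases hx : x ∈ U
    · rw [Set.indicator_of_mem hx]
    · rw [Set.indicator_of_notMem hx, hAU x hx, ENNReal.zero_rpow_of_pos hr]
  rw [eLpNorm_eq_lintegral_rpow_enorm_toReal hq0 hqtop]
  simp only [enorm_eq_self]
  rw [← hrdef, hsupp]
  refine (ENNReal.rpow_le_rpow h2 (by positivity)).trans ?_
  rw [← ENNReal.coe_rpow_of_nonneg _ (by positivity), ← ENNReal.coe_mul, ENNReal.coe_le_coe,
    NNReal.one_rpow, mul_one, NNReal.mul_rpow, ← NNReal.rpow_mul, mul_one_div_cancel hr.ne',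
    NNReal.rpow_one]
  gcongr
  exact le_self_add

end Norms

/-! ### Bounds for the hypersingular sparse operator -/

theorem mainTheorem1 (n : ℕ) (hn : 1 ≤ n) (η K t : ℝ) (hη0 : 0 < η) (hη1 : η < 1)
    (ht1 : 1 < t) (ht2 : t < 1 - Real.logb 2 (1 - η) / (n * K)) :
    -- off the critical line: `L^p → L^q`
    (∀ p q : ℝ≥0∞, 1 ≤ p → 1 ≤ q →
      n * K * (t - 1) / (-Real.logb 2 (1 - η)) < (q⁻¹).toReal - (p⁻¹).toReal →
      ∃ C : ℝ≥0, ∀ S : Set (DyadicCube n),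
        IsSparseFamily η S → IsGradedFamily S → familyDegree S = (K : EReal) →
        ∀ f : (Fin n → ℝ) → ℂ, AEStronglyMeasurable f volume →
          eLpNorm (hypersingularSparse S t f) q volume ≤ C * eLpNorm f p volume) ∧
    -- on the critical line, `q ≠ 1`: `L^{p,∞} → L^{q,∞}`, and `L^p → L^{q,∞}`
    (∀ p q : ℝ≥0∞, 1 ≤ p → 1 ≤ q → q ≠ 1 →
      (q⁻¹).toReal - (p⁻¹).toReal = n * K * (t - 1) / (-Real.logb 2 (1 - η)) →
      ∃ C : ℝ≥0, ∀ S : Set (DyadicCube n),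
        IsSparseFamily η S → IsGradedFamily S → familyDegree S = (K : EReal) →
        ∀ f : (Fin n → ℝ) → ℂ, AEStronglyMeasurable f volume →
          weakLpNorm (hypersingularSparse S t f) q ≤ C * weakLpNorm f p ∧
          weakLpNorm (hypersingularSparse S t f) q ≤ C * eLpNorm f p volume) ∧
    -- on the critical line, `q = 1`: `L^{p,1} → L^{1,∞}`
    (∀ p : ℝ,
      p = -Real.logb 2 (1 - η) / (-Real.logb 2 (1 - η) + n * K * (1 - t)) →
      ∃ C : ℝ≥0, ∀ S : Set (DyadicCube n),
        IsSparseFamily η S → IsGradedFamily S → familyDegree S = (K : EReal) →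
        ∀ f : (Fin n → ℝ) → ℂ, AEStronglyMeasurable f volume →
          weakLpNorm (hypersingularSparse S t f) 1 ≤ C * lorentzOneNorm f p) := by
  have hn' : (0 : ℝ) < n := by exact_mod_cast hn
  have hL : 0 < -Real.logb 2 (1 - η) := by
    have := Real.logb_neg (b := 2) (by norm_num) (show 0 < 1 - η by linarith) (by linarith)
    linarith
  have hquot : 0 < -Real.logb 2 (1 - η) / (n * K) := by rw [neg_div]; linarith
  have hnK : 0 < n * K := (div_pos_iff_of_pos_left hL).1 hquot
  have hK : 0 < K := pos_of_mul_pos_right hnK hn'.le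
  have hM : 0 < n * K * (t - 1) := mul_pos hnK (by linarith)
  have hML : n * K * (t - 1) < -Real.logb 2 (1 - η) := by
    rw [mul_comm, ← lt_div_iff₀ hnK, neg_div]
    linarith
  have hθ : 0 < n * K * (t - 1) / (-Real.logb 2 (1 - η)) := div_pos hM hL
  have hinv : ∀ q : ℝ≥0∞, 1 ≤ q → (q⁻¹).toReal ≤ 1 := fun q hq =>
    ENNReal.toReal_le_of_le_ofReal zero_le_one (by simpa using hq)
  refine ⟨fun p q hp hq hpq => ?_, fun p q hp hq _ hpq => ?_, fun p hp => ?_⟩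
  · -- the critical target exponent for `p` is larger than `q`
    have hq1 := hinv q hq
    obtain ⟨C, hC⟩ := exists_weak_type_bound hn hη0 hη1 hK ht1 (a := (p⁻¹).toReal)
      ENNReal.toReal_nonneg (by linarith)
    obtain ⟨C', hC'⟩ := exists_eLpNorm_le_of_weak (n := n)
      (b := (p⁻¹).toReal + n * K * (t - 1) / (-Real.logb 2 (1 - η)))
      (add_pos_of_nonneg_of_pos ENNReal.toReal_nonneg hθ) (zero_lt_one.trans_le hq).ne'
      (by linarith)
    refine ⟨C' * C, fun S hS hG hdeg f hf => ?_⟩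
    rw [ENNReal.coe_mul, mul_assoc]
    refine hC' _ (DyadicCube.unit n).toSet _ (measurable_hypersingularSparse S t f)
      (DyadicCube.unit n).measurableSet_toSet DyadicCube.volume_unit.le
      (fun x hx => hypersingularSparse_eq_zero hG.subset_unit t f hx) fun s => ?_
    exact hC S hS hG hdeg.le f hf _ ((hasWeakBound_weakLpNorm f).mono
      (weakLpNorm_le_eLpNorm hf (zero_lt_one.trans_le hp).ne')) s
  · have hq1 := hinv q hq
    have hqtop : q ≠ ⊤ := by
      rintro rfl
      have : (0 : ℝ) ≤ (p⁻¹).toReal := ENNReal.toReal_nonneg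
      simp only [ENNReal.inv_top, ENNReal.toReal_zero] at hpq
      linarith
    obtain ⟨C, hC⟩ := exists_weak_type_bound hn hη0 hη1 hK ht1 (a := (p⁻¹).toReal)
      ENNReal.toReal_nonneg (by linarith)
    rw [← hpq, add_sub_cancel, ENNReal.toReal_inv, ENNReal.toReal_inv, ← one_div q.toReal] at hC
    have hweak : ∀ S : Set (DyadicCube n), IsSparseFamily η S → IsGradedFamily S →
        familyDegree S = (K : EReal) → ∀ f : (Fin n → ℝ) → ℂ, AEStronglyMeasurable f volume →
          weakLpNorm (hypersingularSparse S t f) q ≤ C * weakLpNorm f p := by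
      intro S hS hG hdeg f hf
      have hw := hasWeakBound_weakLpNorm f (p := p)
      rw [ENNReal.toReal_inv] at hw
      nth_rewrite 1 [weakLpNorm]
      rw [if_neg hqtop]
      exact iSup_le fun s => hC S hS hG hdeg.le f hf _ hw s
    refine ⟨C, fun S hS hG hdeg f hf => ⟨hweak S hS hG hdeg f hf,
      (hweak S hS hG hdeg f hf).trans ?_⟩⟩
    gcongr
    exact weakLpNorm_le_eLpNorm hf (zero_lt_one.trans_le hp).ne'
  · have hden : 0 < -Real.logb 2 (1 - η) + n * K * (1 - t) := by linarith
    have hp1 : 1 ≤ p := by rw [hp, one_le_div hden]; linarith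
    have hp0 : 0 < p := by linarith
    -- `1 / p = 1 - θ`
    have hpθ : p⁻¹ + n * K * (t - 1) / (-Real.logb 2 (1 - η)) = 1 := by
      rw [hp, inv_div, ← add_div, div_eq_one_iff_eq hL.ne']
      ring
    obtain ⟨C, hC⟩ := exists_weak_type_bound hn hη0 hη1 hK ht1 (a := p⁻¹)
      (inv_nonneg.2 hp0.le) (by linarith)
    rw [hpθ] at hC
    refine ⟨C, fun S hS hG hdeg f hf => ?_⟩
    rw [weakLpNorm, if_neg ENNReal.one_ne_top, ENNReal.toReal_one, div_one]
    have hw := hasWeakBound_weakLpNorm f (p := ENNReal.ofReal p)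
    rw [ENNReal.toReal_inv, ENNReal.toReal_ofReal hp0.le] at hw
    exact iSup_le fun s => hC S hS hG hdeg.le f hf _
      (hw.mono (weakLpNorm_le_lorentzOneNorm f hp1)) s
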